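/- Let $N\ge 2$ and let $G$ and $H$ be finite subgroups of $GL(N,\mathbb{C})$ without fixed points, i.e. $1$ is not an eigenvalue of any element of $G$ or of $H$ other than the identity. For a finite subgroup $\Gamma<GL(N,\mathbb{C})$ let $\mathbb{C}^N/\Gamma=\operatorname{Spec}\mathbb{C}[x_1,\dots,x_N]^{\Gamma}$ be the quotient variety, where $\mathbb{C}[x_1,\dots,x_N]^{\Gamma}$ is the algebra of polynomials invariant under the linear substitutions $x\mapsto \gamma x$, $\gamma\in\Gamma$. Then $\mathbb{C}^N/G$ and $\mathbb{C}^N/H$ are isomorphic as algebraic varieties over $\mathbb{C}$ if and only if $G$ and $H$ are conjugate in $GL(N,\mathbb{C})$, i.e. $H=AGA^{-1}$ for some $A\in GL(N,\mathbb{C})$. -/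

import Mathlib

open CategoryTheory AlgebraicGeometry

/-- Linear substitution in the polynomial ring `ℂ[x₁, …, x_N]`: the polynomial function `f` is sent
to `x ↦ f (A x)`, i.e. `x_i` is replaced by `∑ j, A i j * x_j`. -/
noncomputable def linSubst {N : ℕ} (A : Matrix (Fin N) (Fin N) ℂ) :
    MvPolynomial (Fin N) ℂ →ₐ[ℂ] MvPolynomial (Fin N) ℂ :=
  MvPolynomial.aeval fun i => ∑ j, MvPolynomial.C (A i j) * MvPolynomial.X j

/-- The algebra of invariants `ℂ[x₁, …, x_N]^G` of a subgroup `G` of `GL(N, ℂ)`. -/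
noncomputable def invariantAlgebra {N : ℕ} (G : Subgroup (Matrix.GeneralLinearGroup (Fin N) ℂ)) :
    Subalgebra ℂ (MvPolynomial (Fin N) ℂ) where
  carrier := {f | ∀ g ∈ G, linSubst (g : Matrix (Fin N) (Fin N) ℂ) f = f}
  mul_mem' := fun ha hb g hg => by rw [map_mul, ha g hg, hb g hg]
  add_mem' := fun ha hb g hg => by rw [map_add, ha g hg, hb g hg]
  algebraMap_mem' := fun r g _ => AlgHom.commutes _ r

/-- The quotient variety `ℂ^N / G = Spec ℂ[x₁, …, x_N]^G`, as a scheme over `Spec ℂ`. Isomorphisms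
in `Over (Spec ℂ)` are the isomorphisms of algebraic varieties over `ℂ`. -/
noncomputable def quotientVariety {N : ℕ} (G : Subgroup (Matrix.GeneralLinearGroup (Fin N) ℂ)) :
    Over (Spec (CommRingCat.of ℂ)) :=
  Over.mk (Spec.map (CommRingCat.ofHom (algebraMap ℂ (invariantAlgebra G))))

/-- `G` is a group without fixed points: `1` is not an eigenvalue of any element of `G` except the
identity. -/
def WithoutFixedPoints {N : ℕ} (G : Subgroup (Matrix.GeneralLinearGroup (Fin N) ℂ)) : Prop :=
  ∀ g ∈ G, g ≠ 1 →
    ¬ Module.End.HasEigenvalue (Matrix.toLin' (g : Matrix (Fin N) (Fin N) ℂ)) (1 : ℂ)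

/-- `G` and `H` are conjugate in `GL(N, ℂ)`: `H = A G A⁻¹` for some `A` in `GL(N, ℂ)`. -/
def ConjugateInGL {N : ℕ} (G H : Subgroup (Matrix.GeneralLinearGroup (Fin N) ℂ)) : Prop :=
  ∃ A : Matrix.GeneralLinearGroup (Fin N) ℂ, H = G.map (MulAut.conj A).toMonoidHom

/-!
The variety `ℂ^N / G` determines `G` up to conjugacy because an isomorphism `ℂ^N / G ≅ ℂ^N / H`
lifts to a polynomial automorphism `F` of `ℂ^N`. Such an `F` satisfies `F G F⁻¹ = H`, and its
derivative at the origin conjugates `G` to `H` (`conjugateInGL_of_algEquiv`).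

The lift is the heart of the matter (`exists_algHom_extending`). Since `H` acts freely away from
the origin, `ℂ^N ∖ 0 → (ℂ^N ∖ 0) / H` is a covering (`isCoveringMapOn_evalInvariants`), and the
composite `ℂ^N → ℂ^N / G ≅ ℂ^N / H` meets the image of the origin over finitely many points only,
a single `G`-orbit. It lifts over a small box, chosen such that no coordinate line through the box
meets those points; here `N ≥ 2` is needed. Along such a line the lift continues to all of `ℂ`.
The continuation is holomorphic (`differentiable_of_evalInvariants`), and it has polynomial growth
because the coordinates are integral over the invariants (`exists_norm_le_sum_evalInvariants`); so
it is a polynomial, of a degree bounded independently of the line. A function on a box that is a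
polynomial of bounded degree in each variable is a polynomial
(`exists_mvPolynomial_of_separately`), and the identities that make it a lift, true on the box,
hold everywhere.

Lifts of an isomorphism and of its inverse compose to maps that preserve every orbit, hence to
elements of the groups (`exists_eq_linSubst`), as `ℂ^N` is irreducible. So the lifts are
automorphisms (`exists_algEquiv_extending`).
-/

section

open Topology Filter

variable {N : ℕ} {G : Subgroup (Matrix.GeneralLinearGroup (Fin N) ℂ)}

/-! ### Invariant polynomials and the quotient map on points -/

theorem eval_linSubst (A : Matrix (Fin N) (Fin N) ℂ) (f : MvPolynomial (Fin N) ℂ)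
    (x : Fin N → ℂ) :
    MvPolynomial.eval x (linSubst A f) = MvPolynomial.eval (A.mulVec x) f := by
  induction f using MvPolynomial.induction_on with
  | C a => simp [linSubst]
  | add p q hp hq => simp [hp, hq]
  | mul_X p i hp =>
    rw [map_mul, map_mul, map_mul, hp]
    simp [linSubst, Matrix.mulVec, dotProduct]

theorem linSubst_mul (A B : Matrix (Fin N) (Fin N) ℂ) :
    linSubst (A * B) = (linSubst B).comp (linSubst A) := by
  ext1 i
  refine MvPolynomial.funext fun x => ?_
  simp [eval_linSubst]

@[simp]
theorem linSubst_one : linSubst (1 : Matrix (Fin N) (Fin N) ℂ) = AlgHom.id ℂ _ := by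
  ext1 i
  refine MvPolynomial.funext fun x => ?_
  simp [eval_linSubst]

theorem eval_linSubst_coe (g : G) (f : MvPolynomial (Fin N) ℂ) (x : Fin N → ℂ) :
    MvPolynomial.eval x (linSubst (g : Matrix.GeneralLinearGroup (Fin N) ℂ) f) =
      MvPolynomial.eval (g • x) f :=
  eval_linSubst _ _ _

/-- Evaluation of invariants at the point `x`, i.e. the image of `x` under the quotient map
`ℂ^N → ℂ^N / G`, whose coordinates are all the invariants of `G`. -/
noncomputable def evalInvariants (G : Subgroup (Matrix.GeneralLinearGroup (Fin N) ℂ))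
    (x : Fin N → ℂ) : invariantAlgebra G →ₐ[ℂ] ℂ :=
  (MvPolynomial.aeval x).comp (invariantAlgebra G).val

theorem evalInvariants_apply (x : Fin N → ℂ) (b : invariantAlgebra G) :
    evalInvariants G x b = MvPolynomial.eval x (b : MvPolynomial (Fin N) ℂ) := by
  simp [evalInvariants, MvPolynomial.aeval_eq_eval]

theorem evalInvariants_smul (g : G) (x : Fin N → ℂ) :
    evalInvariants G (g • x) = evalInvariants G x := by
  ext b
  rw [evalInvariants_apply, evalInvariants_apply, ← eval_linSubst_coe, b.2 _ g.2]

/-- The product of the translates of a polynomial is invariant. -/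
theorem exists_invariant_eval_eq_prod [Fintype G] (f : MvPolynomial (Fin N) ℂ) :
    ∃ b : invariantAlgebra G, ∀ x, evalInvariants G x b = ∏ g : G, MvPolynomial.eval (g • x) f := by
  have key : ∀ x, MvPolynomial.eval x
      (∏ g : G, linSubst (g : Matrix.GeneralLinearGroup (Fin N) ℂ) f) =
      ∏ g : G, MvPolynomial.eval (g • x) f := fun x => by
    simp only [map_prod, eval_linSubst_coe]
  refine ⟨⟨∏ g : G, linSubst (g : Matrix.GeneralLinearGroup (Fin N) ℂ) f, fun g hg => ?_⟩,
    fun x => by rw [evalInvariants_apply, key]⟩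
  refine MvPolynomial.funext fun x => ?_
  rw [eval_linSubst_coe ⟨g, hg⟩, key, key]
  refine Fintype.prod_equiv (Equiv.mulRight ⟨g, hg⟩) _ _ fun a => ?_
  simp [mul_smul]

/-- The linear form `φ`, as a polynomial. -/
noncomputable def linearFormPoly (φ : Module.Dual ℂ (Fin N → ℂ)) : MvPolynomial (Fin N) ℂ :=
  ∑ i, MvPolynomial.C (φ (Pi.single i 1)) * MvPolynomial.X i

theorem eval_linearFormPoly (φ : Module.Dual ℂ (Fin N → ℂ)) (x : Fin N → ℂ) :
    MvPolynomial.eval x (linearFormPoly φ) = φ x := by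
  conv_rhs => rw [← Finset.univ_sum_single x]
  simp only [linearFormPoly, map_sum, map_mul, MvPolynomial.eval_C, MvPolynomial.eval_X]
  refine Finset.sum_congr rfl fun i _ => ?_
  rw [mul_comm, ← smul_eq_mul, ← map_smul, ← Pi.single_smul', smul_eq_mul, mul_one]

/-- Invariants of a finite group separate its orbits. -/
theorem evalInvariants_eq_iff [Finite G] {x y : Fin N → ℂ} :
    evalInvariants G x = evalInvariants G y ↔ x ∈ MulAction.orbit G y := by
  refine ⟨fun h => ?_, fun ⟨g, hg⟩ => hg ▸ evalInvariants_smul g y⟩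
  by_contra hx
  have : Fintype G := Fintype.ofFinite G
  obtain ⟨φ, hφ⟩ := Module.exists_dual_forall_apply_ne_zero (K := ℂ)
    (fun g : G => g • y - x) fun g hg => hx ⟨g, sub_eq_zero.1 hg⟩
  obtain ⟨b, hb⟩ := exists_invariant_eval_eq_prod (G := G)
    (linearFormPoly φ - MvPolynomial.C (φ x))
  have h0 : evalInvariants G x b = 0 := by
    rw [hb]
    exact Finset.prod_eq_zero (Finset.mem_univ 1) (by simp [eval_linearFormPoly])
  rw [h, hb] at h0
  obtain ⟨g, -, hg⟩ := Finset.prod_eq_zero_iff.1 h0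
  exact hφ g (by simpa [eval_linearFormPoly] using hg)

/-- The action of `G` on polynomials by `(g • f) x = f (g⁻¹ x)`. The
inverse makes it a left action. -/
@[reducible]
noncomputable def polynomialAction (G : Subgroup (Matrix.GeneralLinearGroup (Fin N) ℂ)) :
    MulSemiringAction G (MvPolynomial (Fin N) ℂ) where
  smul g f := linSubst ((g⁻¹ : G) : Matrix.GeneralLinearGroup (Fin N) ℂ) f
  one_smul f := by
    change linSubst ((1⁻¹ : G) : Matrix.GeneralLinearGroup (Fin N) ℂ) f = f
    simp
  mul_smul g h f := by
    change linSubst (((g * h)⁻¹ : G) : Matrix.GeneralLinearGroup (Fin N) ℂ) f =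
      linSubst ((g⁻¹ : G) : Matrix.GeneralLinearGroup (Fin N) ℂ)
        (linSubst ((h⁻¹ : G) : Matrix.GeneralLinearGroup (Fin N) ℂ) f)
    rw [mul_inv_rev, Subgroup.coe_mul, Units.val_mul, linSubst_mul, AlgHom.comp_apply]
  smul_zero g := map_zero _
  smul_add g := map_add _
  smul_one g := map_one _
  smul_mul g := map_mul _

theorem isIntegral_invariantAlgebra (G : Subgroup (Matrix.GeneralLinearGroup (Fin N) ℂ))
    [Finite G] : Algebra.IsIntegral (invariantAlgebra G) (MvPolynomial (Fin N) ℂ) := by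
  let := polynomialAction G
  have : Algebra.IsInvariant (invariantAlgebra G) (MvPolynomial (Fin N) ℂ) G :=
    ⟨fun f hf => ⟨⟨f, fun g hg => by simpa using! hf (⟨g, hg⟩⁻¹ : G)⟩, rfl⟩⟩
  exact Algebra.IsInvariant.isIntegral (invariantAlgebra G) (MvPolynomial (Fin N) ℂ) G

/-- Every closed point of `Spec` of the invariants is the image of a point of `ℂ^N`. -/
theorem exists_evalInvariants_eq [Finite G] (χ : invariantAlgebra G →ₐ[ℂ] ℂ) :
    ∃ x, evalInvariants G x = χ := by
  have := isIntegral_invariantAlgebra G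
  have hsurj : Function.Surjective χ := fun z => ⟨algebraMap ℂ _ z, by simp⟩
  have hmax : (RingHom.ker χ).IsMaximal := RingHom.ker_isMaximal_of_surjective χ hsurj
  obtain ⟨Q, hQ, hQχ⟩ := Ideal.exists_ideal_over_maximal_of_isIntegral
    (S := MvPolynomial (Fin N) ℂ) (RingHom.ker χ) (by
      rw [(RingHom.injective_iff_ker_eq_bot (algebraMap (invariantAlgebra G)
        (MvPolynomial (Fin N) ℂ))).1 Subtype.val_injective]
      exact bot_le)
  obtain ⟨x, rfl⟩ := (MvPolynomial.isMaximal_iff_eq_vanishingIdeal_singleton).1 hQ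
  refine ⟨x, AlgHom.ext fun b => ?_⟩
  have hb : b - algebraMap ℂ _ (χ b) ∈ RingHom.ker χ := by simp [RingHom.mem_ker]
  rw [← hQχ, Ideal.mem_comap, MvPolynomial.mem_vanishingIdeal_singleton_iff] at hb
  have : evalInvariants G x (b - algebraMap ℂ _ (χ b)) = 0 := hb
  simpa [sub_eq_zero] using this

theorem Polynomial.Monic.norm_le_of_isRoot {p : Polynomial ℂ} (hp : p.Monic) {z : ℂ}
    (hz : p.IsRoot z) {C : ℝ} (hC : 0 ≤ C) (h : ∀ k < p.natDegree, ‖p.coeff k‖ ≤ C) :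
    ‖z‖ ≤ 1 + C := by
  have h1 : ‖z‖ < p.cauchyBound := hz.norm_lt_cauchyBound hp.ne_zero
  have h2 : p.cauchyBound ≤ 1 + C.toNNReal := by
    rw [Polynomial.cauchyBound, hp.leadingCoeff, nnnorm_one, div_one, add_comm]
    gcongr
    exact Finset.sup_le fun k hk => NNReal.le_toNNReal_of_coe_le (h k (Finset.mem_range.1 hk))
  have h3 : (p.cauchyBound : ℝ) ≤ 1 + C := by
    rw [← Real.coe_toNNReal C hC]
    exact_mod_cast h2
  exact h1.le.trans h3

/-- The values of finitely many invariants at a point bound the point, since its coordinates are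
integral over the invariants. -/
theorem exists_norm_le_sum_evalInvariants (G : Subgroup (Matrix.GeneralLinearGroup (Fin N) ℂ))
    [Finite G] : ∃ T : Finset (invariantAlgebra G), ∀ (y : Fin N → ℂ) (i : Fin N),
      ‖y i‖ ≤ 1 + ∑ b ∈ T, ‖evalInvariants G y b‖ := by
  classical
  have := isIntegral_invariantAlgebra G
  choose p hp hp0 using fun i : Fin N =>
    Algebra.IsIntegral.isIntegral (R := invariantAlgebra G) (MvPolynomial.X (R := ℂ) i)
  refine ⟨Finset.univ.biUnion fun i => (p i).coeffs, fun y i => ?_⟩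
  have hroot : ((p i).map (evalInvariants G y : invariantAlgebra G →+* ℂ)).IsRoot (y i) := by
    have := congrArg (MvPolynomial.eval y) (hp0 i)
    rw [Polynomial.hom_eval₂, MvPolynomial.eval_X, map_zero] at this
    rw [Polynomial.IsRoot, Polynomial.eval_map, ← this]
    congr 1
  refine ((hp i).map _).norm_le_of_isRoot hroot
    (Finset.sum_nonneg fun _ _ => norm_nonneg _) fun k _ => ?_
  rw [Polynomial.coeff_map]
  by_cases hk : (p i).coeff k = 0
  · rw [hk, map_zero, norm_zero]
    exact Finset.sum_nonneg fun _ _ => norm_nonneg _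
  · exact Finset.single_le_sum (f := fun b => ‖evalInvariants G y b‖)
      (fun _ _ => norm_nonneg _) (Finset.mem_biUnion.2
        ⟨i, Finset.mem_univ i, Polynomial.coeff_mem_coeffs hk⟩)

/-! ### The quotient map as a covering -/

theorem WithoutFixedPoints.smul_ne (hG : WithoutFixedPoints G) {g : G} (hg : g ≠ 1)
    {x : Fin N → ℂ} (hx : x ≠ 0) : g • x ≠ x := fun h =>
  hG g g.2 (fun h1 => hg (Subtype.ext h1)) <|
    Module.End.hasEigenvalue_of_hasEigenvector
      ⟨Module.End.mem_eigenspace_iff.2 (by rw [one_smul]; exact h), hx⟩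

theorem continuous_evalInvariants (b : invariantAlgebra G) :
    Continuous fun x => evalInvariants G x b := by
  simp only [evalInvariants_apply]
  exact MvPolynomial.continuous_eval _

/-- The quotient map is proper, since points are bounded in terms of their invariants. -/
theorem isProperMap_evalInvariants [Finite G] :
    IsProperMap fun x (b : invariantAlgebra G) => evalInvariants G x b := by
  rw [isProperMap_iff_ultrafilter_of_t2]
  refine ⟨continuous_pi continuous_evalInvariants, fun 𝒰 z hz => ?_⟩
  rw [tendsto_pi_nhds] at hz
  obtain ⟨T, hT⟩ := exists_norm_le_sum_evalInvariants G
  have hev : ∀ᶠ x in (𝒰 : Filter (Fin N → ℂ)), ∀ b ∈ T, ‖evalInvariants G x b‖ ≤ ‖z b‖ + 1 :=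
    (eventually_all_finset T).2 fun b _ =>
      ((hz b).norm.eventually (gt_mem_nhds (lt_add_one ‖z b‖))).mono fun _ h => le_of_lt h
  have hball : Metric.closedBall 0 (1 + ∑ b ∈ T, (‖z b‖ + 1)) ∈ 𝒰 := by
    filter_upwards [hev] with x hx
    rw [mem_closedBall_zero_iff, pi_norm_le_iff_of_nonneg (by positivity)]
    exact fun i => (hT x i).trans (by gcongr with b hb; exact hx b hb)
  obtain ⟨x, -, hx⟩ := (isCompact_closedBall _ _).ultrafilter_le_nhds 𝒰 (le_principal_iff.2 hball)
  exact ⟨x, hx⟩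

theorem properlyDiscontinuousSMul_of_finite [Finite G] : ProperlyDiscontinuousSMul G (Fin N → ℂ) :=
  ⟨fun _ _ => Set.toFinite _⟩

theorem continuousConstSMul_subgroup (G : Subgroup (Matrix.GeneralLinearGroup (Fin N) ℂ)) :
    ContinuousConstSMul G (Fin N → ℂ) :=
  ⟨fun g => (Matrix.toLin' g.1.1).continuous_of_finiteDimensional⟩

/-- Away from the origin, the quotient map by a finite group without fixed points is a covering. -/
theorem isCoveringMapOn_evalInvariants [Finite G] (hG : WithoutFixedPoints G) :
    IsCoveringMapOn (Set.rangeFactorization fun x (b : invariantAlgebra G) => evalInvariants G x b)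
      {z | z.1 ≠ fun b => evalInvariants G 0 b} := by
  have := properlyDiscontinuousSMul_of_finite (G := G)
  have hc := (isProperMap_evalInvariants (G := G)).continuous
  have hq : IsQuotientMap
      (Set.rangeFactorization fun x (b : invariantAlgebra G) => evalInvariants G x b) :=
    (isProperMap_evalInvariants.isClosedMap.subtype_mk _).isQuotientMap (hc.subtype_mk _)
      Set.rangeFactorization_surjective
  have := continuousConstSMul_subgroup G
  refine (hq.isCoveringMapOn_of_properlyDiscontinuousSMul (G := G) fun {x y} => ?_).mono ?_
  · rw [← evalInvariants_eq_iff, Subtype.ext_iff]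
    exact DFunLike.coe_injective.eq_iff
  · rintro ⟨_, x, rfl⟩ hx
    refine ⟨x, (Subgroup.eq_bot_iff_forall _).2 fun g hg => ?_, rfl⟩
    by_contra hg1
    refine hG.smul_ne hg1 (fun h0 => hx ?_) hg
    subst h0
    rfl

/-- Unique lifting through the quotient map `ℂ^N → ℂ^N / G` of maps that avoid the image of the
origin. -/
theorem existsUnique_lift_evalInvariants [Finite G] (hG : WithoutFixedPoints G) {A : Type*}
    [TopologicalSpace A] [SimplyConnectedSpace A] [LocallyPathConnectedSpace A]
    (f : A → invariantAlgebra G →ₐ[ℂ] ℂ) (hf : ∀ b, Continuous fun a => f a b)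
    (hf0 : ∀ a, f a ≠ evalInvariants G 0) (a₀ : A) {y₀ : Fin N → ℂ}
    (h0 : evalInvariants G y₀ = f a₀) :
    ∃! F : C(A, Fin N → ℂ), F a₀ = y₀ ∧ ∀ a, evalInvariants G (F a) = f a := by
  have hr : ∀ a, (fun b => f a b) ∈ Set.range fun x (b : invariantAlgebra G) =>
      evalInvariants G x b := fun a => by
    obtain ⟨x, hx⟩ := exists_evalInvariants_eq (f a)
    exact ⟨x, by simp only [hx]⟩
  have key := (isCoveringMapOn_evalInvariants hG).existsUnique_continuousMap_lifts
    ⟨fun a => ⟨fun b => f a b, hr a⟩, (continuous_pi hf).subtype_mk _⟩ (a₀ := a₀) (e₀ := y₀)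
    (Subtype.ext (congrArg DFunLike.coe h0)) fun a h => hf0 a (DFunLike.coe_injective h)
  convert key using 4 with F
  rw [funext_iff]
  refine forall_congr' fun a => ?_
  rw [Subtype.ext_iff]
  exact DFunLike.coe_injective.eq_iff.symm

/-! ### Polynomial growth, separate polynomials and holomorphic lifts -/

/-- An entire function of polynomial growth is a polynomial. -/
theorem Complex.exists_polynomial_of_norm_le {f : ℂ → ℂ} (hf : Differentiable ℂ f) {C : ℝ} {D : ℕ}
    (h : ∀ t, ‖f t‖ ≤ C * (1 + ‖t‖) ^ D) :
    ∃ p : Polynomial ℂ, p.natDegree ≤ D ∧ ∀ t, p.eval t = f t := by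
  have hC : 0 ≤ C := by simpa using (norm_nonneg _).trans (h 0)
  have hzero : ∀ n, D < n → iteratedDeriv n f 0 = 0 := by
    intro n hn
    have hb : ∀ R : ℝ, 1 ≤ R → ‖iteratedDeriv n f 0‖ ≤ n.factorial * (C * 2 ^ D) * R⁻¹ := by
      intro R hR
      have hR0 : 0 < R := one_pos.trans_le hR
      refine (Complex.norm_iteratedDeriv_le_of_forall_mem_sphere_norm_le n hR0
        hf.diffContOnCl (C := C * (2 * R) ^ D) fun z hz => ?_).trans ?_
      · refine (h z).trans ?_
        rw [mem_sphere_zero_iff_norm.1 hz]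
        gcongr
        linarith
      · rw [mul_pow, ← mul_assoc C, ← mul_assoc, mul_div_assoc]
        gcongr
        rw [div_le_iff₀ (by positivity)]
        calc R ^ D ≤ R ^ (n - 1) := pow_le_pow_right₀ hR (by omega)
          _ = R⁻¹ * R ^ n := by
            obtain ⟨m, rfl⟩ : ∃ m, n = m + 1 := ⟨n - 1, by omega⟩
            rw [pow_succ]; field_simp; simp
    have hlim : Tendsto (fun R : ℝ => n.factorial * (C * 2 ^ D) * R⁻¹) atTop (𝓝 0) := by
      simpa using tendsto_inv_atTop_zero.const_mul (n.factorial * (C * 2 ^ D))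
    exact norm_le_zero_iff.1 <| ge_of_tendsto hlim <|
      (eventually_ge_atTop 1).mono fun R hR => hb R hR
  refine ⟨∑ n ∈ Finset.range (D + 1),
    Polynomial.monomial n ((n.factorial : ℂ)⁻¹ * iteratedDeriv n f 0), ?_, fun t => ?_⟩
  · refine Polynomial.natDegree_sum_le_of_forall_le _ _ fun n hn => ?_
    exact (Polynomial.natDegree_monomial_le _).trans (Nat.lt_succ_iff.1 (Finset.mem_range.1 hn))
  · rw [← Complex.taylorSeries_eq_of_entire' 0 t hf, tsum_eq_sum (s := Finset.range (D + 1)),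
      Polynomial.eval_finsetSum]
    · simp
    · intro n hn
      rw [hzero n (by simpa using hn)]
      simp

/-- A function on a product of infinite sets that is a polynomial of bounded degree in each variable
separately is a polynomial. -/
theorem exists_mvPolynomial_of_separately {K : Type*} [Field K] {σ : Type*} [Fintype σ]
    [DecidableEq σ] {s : σ → Set K} (hs : ∀ i, (s i).Infinite) (D : ℕ) (F : (σ → K) → K)
    (hF : ∀ x ∈ Set.univ.pi s, ∀ j, ∃ p : Polynomial K, p.natDegree ≤ D ∧
      ∀ t ∈ s j, p.eval t = F (Function.update x j t)) :
    ∃ P : MvPolynomial σ K, ∀ x ∈ Set.univ.pi s, MvPolynomial.eval x P = F x := by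
  classical
  suffices key : ∀ (S : Finset σ), ∀ b ∈ Set.univ.pi s, ∃ P : MvPolynomial σ K,
      ∀ x ∈ Set.univ.pi s, (∀ i ∉ S, x i = b i) → MvPolynomial.eval x P = F x by
    choose b hb using fun i => (hs i).nonempty
    obtain ⟨P, hP⟩ := key Finset.univ b fun i _ => hb i
    exact ⟨P, fun x hx => hP x hx fun i hi => absurd (Finset.mem_univ i) hi⟩
  intro S
  induction S using Finset.induction_on with
  | empty =>
    intro b _
    refine ⟨MvPolynomial.C (F b), fun x _ hxb => ?_⟩
    rw [MvPolynomial.eval_C, show x = b from funext fun i => hxb i (Finset.notMem_empty i)]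
  | insert j S hj ih =>
    intro b hb
    obtain ⟨T, hTs, hT⟩ := (hs j).exists_subset_card_eq (D + 1)
    have hmem : ∀ x ∈ Set.univ.pi s, ∀ t ∈ s j, Function.update x j t ∈ Set.univ.pi s :=
      fun x hx t ht => (Set.update_mem_pi_iff_of_mem hx).2 fun _ => ht
    choose! P hP using fun t ht => ih (Function.update b j t) (hmem b hb t ht)
    -- Lagrange interpolation in the variable `j` at the nodes `T`.
    refine ⟨∑ t ∈ T, Polynomial.aeval (MvPolynomial.X j) (Lagrange.basis T id t) *
      MvPolynomial.aeval (Function.update MvPolynomial.X j (MvPolynomial.C t)) (P t),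
      fun x hx hxb => ?_⟩
    obtain ⟨p, hpD, hp⟩ := hF x hx j
    have hpx : p.eval (x j) = F x := by simpa using hp (x j) (hx j trivial)
    have hint : p = Lagrange.interpolate T id fun t => F (Function.update x j t) :=
      Lagrange.eq_interpolate_of_eval_eq _ Function.injective_id.injOn
        ((Polynomial.degree_le_natDegree.trans (Nat.cast_le.2 hpD)).trans_lt (by
          rw [hT]; exact_mod_cast Nat.lt_succ_self D))
        fun t ht => hp t (hTs ht)
    rw [← hpx, hint, Lagrange.interpolate_apply, Polynomial.eval_finsetSum, map_sum]
    refine Finset.sum_congr rfl fun t ht => ?_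
    rw [map_mul, Polynomial.eval_mul, Polynomial.eval_C, mul_comm]
    congr 1
    · rw [← hP t (hTs ht) _ (hmem x hx t (hTs ht))]
      · change MvPolynomial.aeval x (MvPolynomial.aeval _ (P t)) = MvPolynomial.aeval _ (P t)
        rw [← AlgHom.comp_apply, MvPolynomial.comp_aeval]
        congr 2
        ext i
        by_cases hij : i = j
        · subst hij; simp
        · simp [hij]
      · intro i hi
        by_cases hij : i = j
        · subst hij; simp
        · simpa [hij] using hxb i (by simp [hij, hi])
    · change MvPolynomial.aeval x (Polynomial.aeval _ _) = _
      rw [← Polynomial.aeval_algHom_apply, MvPolynomial.aeval_X, Polynomial.coe_aeval_eq_eval]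

theorem isBigO_one_add_norm_pow {a b : ℕ} (hab : a ≤ b) :
    (fun t : ℂ => (1 + ‖t‖) ^ a) =O[⊤] fun t : ℂ => (1 + ‖t‖) ^ b :=
  Asymptotics.isBigO_of_le _ fun t => by
    rw [Real.norm_of_nonneg (by positivity), Real.norm_of_nonneg (by positivity)]
    exact pow_le_pow_right₀ (by simp) hab

/-- The exponent is the same for all lines parallel to the axes. -/
theorem isBigO_eval_update (f : MvPolynomial (Fin N) ℂ) :
    ∃ D : ℕ, ∀ (x : Fin N → ℂ) (j : Fin N),
      (fun t => MvPolynomial.eval (Function.update x j t) f) =O[⊤] fun t : ℂ => (1 + ‖t‖) ^ D := by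
  induction f using MvPolynomial.induction_on with
  | C a =>
    refine ⟨0, fun x j => ?_⟩
    simp only [MvPolynomial.eval_C, pow_zero]
    exact Asymptotics.isBigO_const_const a one_ne_zero ⊤
  | add p q hp hq =>
    obtain ⟨a, ha⟩ := hp
    obtain ⟨b, hb⟩ := hq
    refine ⟨max a b, fun x j => ?_⟩
    simp only [map_add]
    exact ((ha x j).trans (isBigO_one_add_norm_pow (le_max_left _ _))).add
      ((hb x j).trans (isBigO_one_add_norm_pow (le_max_right _ _)))
  | mul_X p i hp =>
    obtain ⟨a, ha⟩ := hp
    refine ⟨a + 1, fun x j => ?_⟩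
    simp only [map_mul, MvPolynomial.eval_X, pow_succ]
    refine (ha x j).mul ?_
    refine Asymptotics.isBigO_top.2 ⟨1 + ‖x i‖, fun t => ?_⟩
    rw [Real.norm_of_nonneg (by positivity : 0 ≤ 1 + ‖t‖)]
    by_cases hij : i = j
    · subst hij
      simp only [Function.update_self]
      nlinarith [norm_nonneg t, norm_nonneg (x i), mul_nonneg (norm_nonneg t) (norm_nonneg (x i))]
    · simp only [Function.update_of_ne hij]
      nlinarith [norm_nonneg t, norm_nonneg (x i), mul_nonneg (norm_nonneg t) (norm_nonneg (x i))]

/-- At a zero of the numerator, the denominator need only be continuous. -/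
theorem differentiableAt_div_of_continuousAt {p Q : ℂ → ℂ} {t₀ : ℂ} (hp : DifferentiableAt ℂ p t₀)
    (hp0 : p t₀ = 0) (hQ : ContinuousAt Q t₀) (hQ0 : Q t₀ ≠ 0) :
    DifferentiableAt ℂ (fun t => p t / Q t) t₀ := by
  have h := hp.hasDerivAt
  rw [hasDerivAt_iff_tendsto_slope] at h
  refine HasDerivAt.differentiableAt (f' := deriv p t₀ / Q t₀) ?_
  rw [hasDerivAt_iff_tendsto_slope]
  refine (h.div (hQ.tendsto.mono_left nhdsWithin_le_nhds) hQ0).congr fun t => ?_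
  simp only [slope_def_field, hp0, zero_div, sub_zero, Pi.div_apply]
  rw [div_right_comm]

/-- If the linear form `φ` separates `y = c t₀` from its translates, then `φ (c t)` is holomorphic
at `t₀`: the invariant `∏ g, (φ (g • c t) - φ y)` is the product of `φ (c t) - φ y` with a
continuous function that does not vanish at `t₀`. -/
theorem differentiableAt_linearForm [Finite G] {c : ℂ → Fin N → ℂ} (hc : Continuous c)
    (hd : ∀ b, Differentiable ℂ fun t => evalInvariants G (c t) b) {t₀ : ℂ}
    {φ : Module.Dual ℂ (Fin N → ℂ)} (hφ : ∀ g : G, g ≠ 1 → φ (g • c t₀ - c t₀) ≠ 0) :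
    DifferentiableAt ℂ (fun t => φ (c t)) t₀ := by
  classical
  have : Fintype G := Fintype.ofFinite G
  obtain ⟨b, hb⟩ := exists_invariant_eval_eq_prod (G := G)
    (linearFormPoly φ - MvPolynomial.C (φ (c t₀)))
  simp only [map_sub, eval_linearFormPoly, MvPolynomial.eval_C] at hb
  have := continuousConstSMul_subgroup G
  have hφc : Continuous φ := φ.continuous_of_finiteDimensional
  let Q : ℂ → ℂ := fun t => ∏ g ∈ Finset.univ.erase (1 : G), (φ (g • c t) - φ (c t₀))
  have hQc : Continuous Q := by
    refine continuous_finsetProd _ fun g _ => ?_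
    exact (hφc.comp (hc.const_smul g)).sub continuous_const
  have hQ0 : Q t₀ ≠ 0 := Finset.prod_ne_zero_iff.2 fun g hg => by
    rw [← map_sub]
    exact hφ g (Finset.ne_of_mem_erase hg)
  have hbQ : ∀ t, evalInvariants G (c t) b = (φ (c t) - φ (c t₀)) * Q t := fun t => by
    rw [hb, ← Finset.mul_prod_erase _ _ (Finset.mem_univ (1 : G)), one_smul]
  have h := (differentiableAt_div_of_continuousAt (hd b t₀) (by rw [hbQ, sub_self, zero_mul])
    hQc.continuousAt hQ0).add_const (φ (c t₀))
  refine h.congr_of_eventuallyEq ?_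
  filter_upwards [hQc.continuousAt.eventually_ne hQ0] with t ht
  rw [hbQ, mul_div_cancel_right₀ _ ht, sub_add_cancel]

/-- Continuous lifts through the quotient map of holomorphic maps are holomorphic. -/
theorem differentiable_of_evalInvariants [Finite G] (hG : WithoutFixedPoints G)
    {c : ℂ → Fin N → ℂ} (hc : Continuous c) (hc0 : ∀ t, c t ≠ 0)
    (hd : ∀ b, Differentiable ℂ fun t => evalInvariants G (c t) b) (i : Fin N) :
    Differentiable ℂ fun t => c t i := by
  intro t₀
  have : Fintype G := Fintype.ofFinite G
  obtain ⟨φ, hφ⟩ := Module.exists_dual_forall_apply_ne_zero (K := ℂ)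
    (fun g : {g : G // g ≠ 1} => g.1 • c t₀ - c t₀) fun g => sub_ne_zero.2 (hG.smul_ne g.2 (hc0 t₀))
  let e : Module.Dual ℂ (Fin N → ℂ) := LinearMap.proj i
  -- The coordinate form `e` is a combination of `φ` and `φ + s • e`, both separating.
  obtain ⟨s, hs⟩ := Infinite.exists_notMem_finset (insert 0 (Finset.univ.image fun g : G =>
    -(φ (g • c t₀ - c t₀) / e (g • c t₀ - c t₀))))
  rw [Finset.mem_insert, not_or] at hs
  have h1 := differentiableAt_linearForm (φ := φ) hc hd fun g hg => hφ ⟨g, hg⟩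
  have h2 := differentiableAt_linearForm (φ := φ + s • e) (t₀ := t₀) hc hd fun g hg h0 => by
    have hv := hφ ⟨g, hg⟩
    rw [LinearMap.add_apply, LinearMap.smul_apply, smul_eq_mul] at h0
    refine hs.2 (Finset.mem_image.2 ⟨g, Finset.mem_univ g, ?_⟩)
    have he : e (g • c t₀ - c t₀) ≠ 0 := fun he => hv (by rwa [he, mul_zero, add_zero] at h0)
    field_simp
    linear_combination -h0
  have h3 := (h2.sub h1).const_mul s⁻¹
  refine h3.congr_of_eventuallyEq (Eventually.of_forall fun t => ?_)
  simp [e, inv_mul_cancel_left₀ hs.1]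

/-! ### Extending homomorphisms from the invariants to all polynomials -/

theorem differentiable_eval_update (f : MvPolynomial (Fin N) ℂ) (x : Fin N → ℂ) (j : Fin N) :
    Differentiable ℂ fun t => MvPolynomial.eval (Function.update x j t) f := by
  induction f using MvPolynomial.induction_on with
  | C a => simp
  | add p q hp hq =>
    simp only [map_add]
    exact hp.add hq
  | mul_X p i hp =>
    simp only [map_mul, MvPolynomial.eval_X]
    refine hp.mul ?_
    by_cases hij : i = j
    · subst hij
      simp
    · simp [Function.update_of_ne hij]

/-- Lifts of coordinate lines have polynomial growth, with an exponent that does not depend on the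
line. -/
theorem exists_pow_bound_of_lift (H : Subgroup (Matrix.GeneralLinearGroup (Fin N) ℂ)) [Finite H]
    (θ : invariantAlgebra H →ₐ[ℂ] MvPolynomial (Fin N) ℂ) :
    ∃ D : ℕ, ∀ (x : Fin N → ℂ) (j : Fin N) (c : ℂ → Fin N → ℂ),
      (∀ t, evalInvariants H (c t) = (MvPolynomial.aeval (Function.update x j t)).comp θ) →
      ∀ i, ∃ C : ℝ, ∀ t, ‖c t i‖ ≤ C * (1 + ‖t‖) ^ D := by
  obtain ⟨T, hT⟩ := exists_norm_le_sum_evalInvariants H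
  choose D hD using fun b => isBigO_eval_update (θ b)
  refine ⟨T.sup D, fun x j c hc i => ?_⟩
  have h1 : (fun t => 1 + ∑ b ∈ T, ‖evalInvariants H (c t) b‖) =O[⊤]
      fun t : ℂ => (1 + ‖t‖) ^ T.sup D := by
    refine .add ?_ (.fun_sum fun b hb => ?_)
    · simpa only [pow_zero] using! isBigO_one_add_norm_pow (Nat.zero_le (T.sup D))
    · refine ((hD b x j).trans (isBigO_one_add_norm_pow (Finset.le_sup hb))).norm_left.congr_left
        fun t => ?_
      rw [hc, AlgHom.comp_apply, MvPolynomial.aeval_eq_eval]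
  obtain ⟨C, hC⟩ := Asymptotics.isBigO_top.1 h1
  refine ⟨C, fun t => (hT (c t) i).trans ((le_abs_self _).trans ?_)⟩
  have := hC t
  rwa [Real.norm_eq_abs, Real.norm_of_nonneg (by positivity)] at this

/-- A homomorphism from the invariants of a group without fixed points to polynomials extends to all
polynomials, provided that only finitely many points are mapped to the image of the origin. -/
theorem exists_algHom_extending (hN : 2 ≤ N) {H : Subgroup (Matrix.GeneralLinearGroup (Fin N) ℂ)}
    [Finite H] (hH : WithoutFixedPoints H)
    (θ : invariantAlgebra H →ₐ[ℂ] MvPolynomial (Fin N) ℂ)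
    (hfin : {x | (MvPolynomial.aeval x).comp θ = evalInvariants H 0}.Finite) :
    ∃ Φ : MvPolynomial (Fin N) ℂ →ₐ[ℂ] MvPolynomial (Fin N) ℂ,
      ∀ b : invariantAlgebra H, Φ b = θ b := by
  classical
  have : Nontrivial (Fin N) := Fin.nontrivial_iff_two_le.2 hN
  choose q hq using fun j : Fin N =>
    Infinite.exists_notMem_finset (hfin.toFinset.image fun p => p j)
  have hev : ∀ᶠ x in 𝓝 q, ∀ p ∈ hfin.toFinset, ∀ j, x j ≠ p j :=
    (eventually_all_finset _).2 fun p hp => eventually_all.2 fun j =>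
      (continuous_apply j).continuousAt.eventually_ne fun h =>
        hq j (Finset.mem_image.2 ⟨p, hp, h.symm⟩)
  obtain ⟨ε, hε, hball⟩ := Metric.eventually_nhds_iff_ball.1 hev
  -- Coordinate lines through the box avoid the exceptional points, since `N ≥ 2`.
  have hline : ∀ x ∈ Metric.ball q ε, ∀ j t,
      (MvPolynomial.aeval (Function.update x j t)).comp θ ≠ evalInvariants H 0 := by
    intro x hx j t h
    obtain ⟨i, hi⟩ := exists_ne j
    exact hball x hx _ (hfin.mem_toFinset.2 h) i (by simp [hi])
  have hpi : Metric.ball q ε = Set.univ.pi fun j => Metric.ball (q j) ε := ball_pi q hε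
  have hupd : ∀ x ∈ Metric.ball q ε, ∀ j, ∀ t ∈ Metric.ball (q j) ε,
      Function.update x j t ∈ Metric.ball q ε := by
    intro x hx j t ht
    rw [hpi] at hx ⊢
    exact (Set.update_mem_pi_iff_of_mem hx).2 fun _ => ht
  have hq0 : q ∈ Metric.ball q ε := Metric.mem_ball_self hε
  have := (convex_ball q ε).contractibleSpace ⟨q, hq0⟩
  have := (Metric.isOpen_ball (x := q) (ε := ε)).locallyPathConnectedSpace
  obtain ⟨y₀, hy₀⟩ := exists_evalInvariants_eq ((MvPolynomial.aeval q).comp θ)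
  obtain ⟨F, ⟨-, hF⟩, -⟩ := existsUnique_lift_evalInvariants hH
    (fun x : Metric.ball q ε => (MvPolynomial.aeval x.1).comp θ)
    (fun b => (MvPolynomial.continuous_eval (θ b)).comp continuous_subtype_val)
    (fun x h => hline x.1 x.2 ⟨0, by omega⟩ (x.1 ⟨0, by omega⟩) (by simpa using h))
    ⟨q, hq0⟩ hy₀
  -- On a coordinate line, `F` continues to an entire lift of polynomial growth.
  obtain ⟨D, hD⟩ := exists_pow_bound_of_lift H θ
  have hsep : ∀ i, ∃ P : MvPolynomial (Fin N) ℂ, ∀ x ∈ Set.univ.pi fun j => Metric.ball (q j) ε,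
      MvPolynomial.eval x P = if h : x ∈ Metric.ball q ε then F ⟨x, h⟩ i else 0 := by
    intro i
    refine exists_mvPolynomial_of_separately
      (fun j => infinite_of_mem_nhds (q j) (Metric.ball_mem_nhds _ hε)) D _ fun x hx j => ?_
    have hxj := hx j trivial
    rw [← hpi] at hx
    have hlinecont : Continuous fun t => Function.update x j t := by fun_prop
    obtain ⟨c, ⟨hc0, hc⟩, -⟩ := existsUnique_lift_evalInvariants hH
      (fun t : ℂ => (MvPolynomial.aeval (Function.update x j t)).comp θ)
      (fun b => (MvPolynomial.continuous_eval (θ b)).comp hlinecont)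
      (fun t => hline x hx j t) (x j) (y₀ := F ⟨x, hx⟩) (by simpa using hF ⟨x, hx⟩)
    -- On the part of the line inside the box, `F` and `c` are lifts of the same map.
    have hcF : ∀ t (ht : t ∈ Metric.ball (q j) ε), c t = F ⟨Function.update x j t,
        hupd x hx j t ht⟩ := by
      have := (convex_ball (q j) ε).contractibleSpace ⟨x j, hxj⟩
      have := (Metric.isOpen_ball (x := q j) (ε := ε)).locallyPathConnectedSpace
      have huniq := existsUnique_lift_evalInvariants hH
        (fun t : Metric.ball (q j) ε => (MvPolynomial.aeval (Function.update x j t.1)).comp θ)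
        (fun b => (MvPolynomial.continuous_eval (θ b)).comp
          (hlinecont.comp continuous_subtype_val))
        (fun t => hline x hx j t) ⟨x j, hxj⟩ (y₀ := F ⟨x, hx⟩) (by simpa using hF ⟨x, hx⟩)
      have heq := huniq.unique (y₁ := ⟨fun t => c t.1, by fun_prop⟩)
        (y₂ := ⟨fun t => F ⟨Function.update x j t.1, hupd x hx j t.1 t.2⟩,
          F.continuous.comp ((hlinecont.comp continuous_subtype_val).subtype_mk _)⟩)
        ⟨hc0, fun t => hc t⟩ ⟨by simp, fun t => hF _⟩
      exact fun t ht => DFunLike.congr_fun heq ⟨t, ht⟩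
    obtain ⟨C, hC⟩ := hD x j c hc i
    obtain ⟨p, hpD, hp⟩ := Complex.exists_polynomial_of_norm_le
      (differentiable_of_evalInvariants hH c.continuous
        (fun t h0 => hline x hx j t (by rw [← hc, h0]))
        (fun b => by
          simp only [hc]
          exact differentiable_eval_update (θ b) x j) i) hC
    refine ⟨p, hpD, fun t ht => ?_⟩
    rw [hp, hcF t ht, dif_pos (hupd x hx j t ht)]
  choose P hP using hsep
  refine ⟨MvPolynomial.aeval P, fun b => ?_⟩
  refine MvPolynomial.funext_set (fun j => Metric.ball (q j) ε)
    (fun j => infinite_of_mem_nhds (q j) (Metric.ball_mem_nhds _ hε)) fun x hx => ?_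
  have hx' := hx
  rw [← hpi] at hx'
  have hPF : (fun i => MvPolynomial.aeval x (P i)) = F ⟨x, hx'⟩ := by
    ext i
    rw [MvPolynomial.aeval_eq_eval]
    exact (hP i x hx).trans (dif_pos hx')
  change MvPolynomial.aeval x (MvPolynomial.aeval P b.1) = MvPolynomial.aeval x (θ b)
  rw [← AlgHom.comp_apply, MvPolynomial.comp_aeval, hPF]
  exact DFunLike.congr_fun (hF ⟨x, hx'⟩) b

/-! ### Automorphisms of the polynomial ring and their linear parts -/

/-- An endomorphism of the polynomial ring that fixes the invariants of a finite group is
a substitution by one of its elements. -/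
theorem exists_eq_linSubst [Finite G] (E : MvPolynomial (Fin N) ℂ →ₐ[ℂ] MvPolynomial (Fin N) ℂ)
    (hE : ∀ b : invariantAlgebra G, E b = b) :
    ∃ g ∈ G, E = linSubst (g : Matrix (Fin N) (Fin N) ℂ) := by
  have : Fintype G := Fintype.ofFinite G
  by_contra! hne
  have hi : ∀ g : G, ∃ i, E (MvPolynomial.X i) -
      linSubst (g : Matrix.GeneralLinearGroup (Fin N) ℂ) (MvPolynomial.X i) ≠ 0 := fun g => by
    by_contra! h
    exact hne g g.2 (MvPolynomial.algHom_ext fun i => sub_eq_zero.1 (h i))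
  choose i hi using hi
  -- The product of these nonzero polynomials vanishes everywhere: each `x` is moved within its orbit.
  refine Finset.prod_ne_zero_iff.2 (fun g (_ : g ∈ Finset.univ) => hi g) ?_
  refine MvPolynomial.funext fun x => ?_
  have hx : evalInvariants G (fun i => MvPolynomial.aeval x (E (MvPolynomial.X i))) =
      evalInvariants G x := AlgHom.ext fun b => by
    have h : MvPolynomial.aeval (fun i => MvPolynomial.aeval x (E (MvPolynomial.X i))) =
        (MvPolynomial.aeval x).comp E := by ext1 i; simp
    rw [evalInvariants, evalInvariants, h]
    simp [hE]
  obtain ⟨g, hg⟩ := evalInvariants_eq_iff.1 hx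
  rw [map_prod, map_zero]
  refine Finset.prod_eq_zero (Finset.mem_univ g) ?_
  rw [map_sub, eval_linSubst_coe, MvPolynomial.eval_X, sub_eq_zero]
  exact (congrFun hg (i g)).symm

/-- The Jacobian matrix at the origin of the polynomial map `ℂ^N → ℂ^N` given by an endomorphism of
the polynomial ring. -/
noncomputable def jacobianAtZero (E : MvPolynomial (Fin N) ℂ →ₐ[ℂ] MvPolynomial (Fin N) ℂ) :
    Matrix (Fin N) (Fin N) ℂ :=
  Matrix.of fun i j => MvPolynomial.eval 0 (MvPolynomial.pderiv j (E (MvPolynomial.X i)))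

/-- The chain rule for an endomorphism of the polynomial ring. -/
theorem pderiv_algHom_apply (E : MvPolynomial (Fin N) ℂ →ₐ[ℂ] MvPolynomial (Fin N) ℂ)
    (j : Fin N) (f : MvPolynomial (Fin N) ℂ) :
    MvPolynomial.pderiv j (E f) =
      ∑ k, E (MvPolynomial.pderiv k f) * MvPolynomial.pderiv j (E (MvPolynomial.X k)) := by
  induction f using MvPolynomial.induction_on with
  | C a => simp [← MvPolynomial.algebraMap_eq]
  | add p q hp hq => simp only [map_add, hp, hq, add_mul, Finset.sum_add_distrib]
  | mul_X p i hp =>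
    have hk : ∀ k, E (MvPolynomial.pderiv k (p * MvPolynomial.X i)) *
        MvPolynomial.pderiv j (E (MvPolynomial.X k)) =
        E (MvPolynomial.pderiv k p) * MvPolynomial.pderiv j (E (MvPolynomial.X k)) *
          E (MvPolynomial.X i) + E p * (E (MvPolynomial.pderiv k (MvPolynomial.X i)) *
            MvPolynomial.pderiv j (E (MvPolynomial.X k))) := fun k => by
      rw [MvPolynomial.pderiv_mul, map_add, map_mul, map_mul]
      ring
    have hX : ∑ k, E (MvPolynomial.pderiv k (MvPolynomial.X i)) *
        MvPolynomial.pderiv j (E (MvPolynomial.X k)) =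
        MvPolynomial.pderiv j (E (MvPolynomial.X i)) := by
      rw [Finset.sum_eq_single i (fun k _ hki => by
        rw [MvPolynomial.pderiv_X_of_ne hki.symm, map_zero, zero_mul]) (by simp),
        MvPolynomial.pderiv_X_self, map_one, one_mul]
    rw [map_mul, MvPolynomial.pderiv_mul, hp, Finset.sum_mul,
      Finset.sum_congr rfl fun k _ => hk k, Finset.sum_add_distrib, ← Finset.mul_sum, hX]

theorem pderiv_linSubst_X (A : Matrix (Fin N) (Fin N) ℂ) (i j : Fin N) :
    MvPolynomial.pderiv j (linSubst A (MvPolynomial.X i)) = MvPolynomial.C (A i j) := by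
  simp [linSubst, MvPolynomial.pderiv_X, Pi.single_apply]

theorem jacobianAtZero_comp_linSubst
    (E : MvPolynomial (Fin N) ℂ →ₐ[ℂ] MvPolynomial (Fin N) ℂ) (A : Matrix (Fin N) (Fin N) ℂ) :
    jacobianAtZero (E.comp (linSubst A)) = A * jacobianAtZero E := by
  ext i j
  simp only [jacobianAtZero, Matrix.of_apply, AlgHom.comp_apply, Matrix.mul_apply]
  rw [pderiv_algHom_apply]
  simp only [pderiv_linSubst_X, map_sum, map_mul, ← MvPolynomial.algebraMap_eq, AlgHom.commutes]
  simp

theorem jacobianAtZero_linSubst_comp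
    (E : MvPolynomial (Fin N) ℂ →ₐ[ℂ] MvPolynomial (Fin N) ℂ) (A : Matrix (Fin N) (Fin N) ℂ) :
    jacobianAtZero ((linSubst A).comp E) = jacobianAtZero E * A := by
  ext i j
  simp only [jacobianAtZero, Matrix.of_apply, AlgHom.comp_apply, Matrix.mul_apply]
  rw [pderiv_algHom_apply]
  simp only [map_sum, map_mul, pderiv_linSubst_X, MvPolynomial.eval_C, eval_linSubst,
    Matrix.mulVec_zero]

/-- With `F` and `F'` the polynomial maps of `E` and `E'`, the hypothesis says `F' ∘ F = id`, so the
derivative of `F'` at `F 0` is inverse to that of `F` at `0`. The origin need not be fixed. -/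
theorem isUnit_jacobianAtZero {E E' : MvPolynomial (Fin N) ℂ →ₐ[ℂ] MvPolynomial (Fin N) ℂ}
    (h : E.comp E' = AlgHom.id ℂ _) : IsUnit (jacobianAtZero E) := by
  refine IsUnit.of_mul_eq_one_right (Matrix.of fun i k => MvPolynomial.eval 0
    (E (MvPolynomial.pderiv k (E' (MvPolynomial.X i))))) ?_
  ext i j
  have h1 := congrArg (MvPolynomial.eval 0) (pderiv_algHom_apply E j (E' (MvPolynomial.X i)))
  rw [← AlgHom.comp_apply, h] at h1
  simp only [Matrix.mul_apply, Matrix.of_apply, jacobianAtZero, map_sum, map_mul] at h1 ⊢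
  rw [← h1]
  simp [MvPolynomial.pderiv_X, Matrix.one_apply, Pi.single_apply, apply_ite, eq_comm]

/-- The points of `ℂ^N` lying over a given point of `ℂ^N / H`, by way of an isomorphism of
`ℂ^N / G` with `ℂ^N / H`, form a single `G`-orbit. -/
theorem finite_setOf_aeval_comp_eq {H : Subgroup (Matrix.GeneralLinearGroup (Fin N) ℂ)} [Finite G]
    (e : invariantAlgebra H ≃ₐ[ℂ] invariantAlgebra G) (χ : invariantAlgebra H →ₐ[ℂ] ℂ) :
    {x | (MvPolynomial.aeval x).comp ((invariantAlgebra G).val.comp e.toAlgHom) = χ}.Finite := by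
  obtain ⟨y, hy⟩ := exists_evalInvariants_eq (χ.comp e.symm.toAlgHom)
  refine (Set.finite_range fun g : G => g • y).subset fun x hx => ?_
  refine evalInvariants_eq_iff.1 (AlgHom.ext fun b => ?_)
  have hx' : _ = χ := hx
  rw [hy, ← hx']
  simp [evalInvariants]

/-- An isomorphism of invariant algebras extends to an automorphism of the polynomial ring: the
extensions of `e` and of its inverse compose to substitutions by elements of `G` and `H`. -/
theorem exists_algEquiv_extending (hN : 2 ≤ N)
    {H : Subgroup (Matrix.GeneralLinearGroup (Fin N) ℂ)} [Finite G] [Finite H]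
    (hG : WithoutFixedPoints G) (hH : WithoutFixedPoints H)
    (e : invariantAlgebra H ≃ₐ[ℂ] invariantAlgebra G) :
    ∃ Φ : MvPolynomial (Fin N) ℂ ≃ₐ[ℂ] MvPolynomial (Fin N) ℂ,
      ∀ b : invariantAlgebra H, Φ b = e b := by
  obtain ⟨Φ, hΦ⟩ := exists_algHom_extending hN hH _
    (finite_setOf_aeval_comp_eq e (evalInvariants H 0))
  obtain ⟨Ψ, hΨ⟩ := exists_algHom_extending hN hG _
    (finite_setOf_aeval_comp_eq e.symm (evalInvariants G 0))
  replace hΦ : ∀ b : invariantAlgebra H, Φ b = e b := hΦ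
  replace hΨ : ∀ b : invariantAlgebra G, Ψ b = e.symm b := hΨ
  have bij : ∀ g : Matrix.GeneralLinearGroup (Fin N) ℂ,
      Function.Bijective (linSubst (g : Matrix (Fin N) (Fin N) ℂ)) := fun g => by
    refine Function.bijective_iff_has_inverse.2
      ⟨linSubst ((g⁻¹ : Matrix.GeneralLinearGroup (Fin N) ℂ) : Matrix (Fin N) (Fin N) ℂ),
        fun f => ?_, fun f => ?_⟩ <;>
    · rw [← AlgHom.comp_apply, ← linSubst_mul, ← Units.val_mul]
      simp
  obtain ⟨g, -, hg⟩ := exists_eq_linSubst (G := G) (Φ.comp Ψ) fun b => by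
    simp [hΦ, hΨ]
  obtain ⟨h, -, hh⟩ := exists_eq_linSubst (G := H) (Ψ.comp Φ) fun b => by
    simp [hΦ, hΨ]
  refine ⟨AlgEquiv.ofBijective Φ ⟨?_, ?_⟩, hΦ⟩
  · have := (bij h).1
    rw [← hh] at this
    exact Function.Injective.of_comp this
  · have := (bij g).2
    rw [← hg] at this
    exact Function.Surjective.of_comp this

/-- An automorphism that extends an isomorphism of invariant algebras conjugates elements of `G`
into `H`: its conjugate of `g ∈ G` fixes the invariants of `H`. -/
theorem exists_linSubst_comp_comm {H : Subgroup (Matrix.GeneralLinearGroup (Fin N) ℂ)} [Finite H]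
    {e : invariantAlgebra H ≃ₐ[ℂ] invariantAlgebra G}
    {Φ : MvPolynomial (Fin N) ℂ ≃ₐ[ℂ] MvPolynomial (Fin N) ℂ}
    (hΦ : ∀ b : invariantAlgebra H, Φ b = e b)
    {g : Matrix.GeneralLinearGroup (Fin N) ℂ} (hg : g ∈ G) :
    ∃ h ∈ H, Φ.toAlgHom.comp (linSubst (h : Matrix (Fin N) (Fin N) ℂ)) =
      (linSubst (g : Matrix (Fin N) (Fin N) ℂ)).comp Φ.toAlgHom := by
  obtain ⟨h, hh, heq⟩ := exists_eq_linSubst (G := H)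
    (Φ.symm.toAlgHom.comp ((linSubst (g : Matrix (Fin N) (Fin N) ℂ)).comp Φ.toAlgHom)) fun b => by
      change Φ.symm (linSubst (g : Matrix (Fin N) (Fin N) ℂ) (Φ b)) = b
      rw [hΦ, (e b).2 g hg, ← hΦ, AlgEquiv.symm_apply_apply]
  refine ⟨h, hh, ?_⟩
  rw [← heq]
  ext1 i
  simp

/-- The polynomial automorphism `F` extending `e` satisfies `F ∘ g = h ∘ F` for corresponding `g ∈
G` and `h ∈ H`. As `g` and `h` are linear, the derivative of `F` at the origin intertwines them. -/
theorem conjugateInGL_of_algEquiv (hN : 2 ≤ N)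
    {H : Subgroup (Matrix.GeneralLinearGroup (Fin N) ℂ)} [Finite G] [Finite H]
    (hG : WithoutFixedPoints G) (hH : WithoutFixedPoints H)
    (e : invariantAlgebra H ≃ₐ[ℂ] invariantAlgebra G) : ConjugateInGL G H := by
  obtain ⟨Φ, hΦ⟩ := exists_algEquiv_extending hN hG hH e
  have hΦ' : ∀ b : invariantAlgebra G, Φ.symm b = e.symm b := fun b => by
    rw [AlgEquiv.symm_apply_eq, hΦ, AlgEquiv.apply_symm_apply]
  obtain ⟨A, hA⟩ := isUnit_jacobianAtZero (E := Φ.toAlgHom) (E' := Φ.symm.toAlgHom)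
    (by ext1 i; simp)
  have key : ∀ g h : Matrix.GeneralLinearGroup (Fin N) ℂ,
      Φ.toAlgHom.comp (linSubst (h : Matrix (Fin N) (Fin N) ℂ)) =
        (linSubst (g : Matrix (Fin N) (Fin N) ℂ)).comp Φ.toAlgHom → A * g * A⁻¹ = h := by
    intro g h heq
    have := congrArg jacobianAtZero heq
    rw [jacobianAtZero_comp_linSubst, jacobianAtZero_linSubst_comp, ← hA] at this
    rw [mul_inv_eq_iff_eq_mul]
    exact Units.ext this.symm
  refine ⟨A, le_antisymm (fun h hh => ?_) ?_⟩
  · obtain ⟨g, hg, heq⟩ := exists_linSubst_comp_comm hΦ' hh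
    refine ⟨g, hg, key g h ?_⟩
    ext1 i
    have h1 := DFunLike.congr_fun heq (Φ (MvPolynomial.X i))
    have h2 := congrArg Φ h1
    simpa using h2.symm
  · rintro _ ⟨g, hg, rfl⟩
    obtain ⟨h, hh, heq⟩ := exists_linSubst_comp_comm hΦ hg
    have := key g h heq
    simpa [this] using hh

/-! ### Conjugate groups, and morphisms of affine schemes -/

theorem linSubst_mem_invariantAlgebra {H : Subgroup (Matrix.GeneralLinearGroup (Fin N) ℂ)}
    {A : Matrix.GeneralLinearGroup (Fin N) ℂ} (hA : ∀ g ∈ G, A * g * A⁻¹ ∈ H)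
    {f : MvPolynomial (Fin N) ℂ} (hf : f ∈ invariantAlgebra H) :
    linSubst (A : Matrix (Fin N) (Fin N) ℂ) f ∈ invariantAlgebra G := fun g hg => by
  rw [← AlgHom.comp_apply, ← linSubst_mul, ← Units.val_mul,
    show A * g = A * g * A⁻¹ * A by group, Units.val_mul, linSubst_mul, AlgHom.comp_apply,
    hf _ (hA g hg)]

/-- Conjugate groups have isomorphic invariant algebras, by linear substitution. -/
noncomputable def invariantAlgebraEquiv {H : Subgroup (Matrix.GeneralLinearGroup (Fin N) ℂ)}
    (A : Matrix.GeneralLinearGroup (Fin N) ℂ) (hA : ∀ g ∈ G, A * g * A⁻¹ ∈ H)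
    (hA' : ∀ h ∈ H, A⁻¹ * h * A ∈ G) : invariantAlgebra H ≃ₐ[ℂ] invariantAlgebra G :=
  AlgEquiv.ofAlgHom
    (((linSubst (A : Matrix (Fin N) (Fin N) ℂ)).comp (invariantAlgebra H).val).codRestrict _
      fun f => linSubst_mem_invariantAlgebra hA f.2)
    (((linSubst ((A⁻¹ : Matrix.GeneralLinearGroup (Fin N) ℂ) : Matrix (Fin N) (Fin N) ℂ)).comp
      (invariantAlgebra G).val).codRestrict _
      fun f => linSubst_mem_invariantAlgebra (by simpa using hA') f.2)
    (AlgHom.ext fun f => Subtype.ext <| by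
      change linSubst _ (linSubst _ f.1) = f.1
      rw [← AlgHom.comp_apply, ← linSubst_mul, ← Units.val_mul]
      simp)
    (AlgHom.ext fun f => Subtype.ext <| by
      change linSubst _ (linSubst _ f.1) = f.1
      rw [← AlgHom.comp_apply, ← linSubst_mul, ← Units.val_mul]
      simp)

theorem nonempty_iso_iff_nonempty_algEquiv
    (G H : Subgroup (Matrix.GeneralLinearGroup (Fin N) ℂ)) :
    Nonempty (quotientVariety G ≅ quotientVariety H) ↔
      Nonempty (invariantAlgebra H ≃ₐ[ℂ] invariantAlgebra G) := by
  constructor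
  · rintro ⟨i⟩
    let j : Spec (CommRingCat.of (invariantAlgebra G)) ≅
        Spec (CommRingCat.of (invariantAlgebra H)) :=
      (Over.forget _).mapIso i
    let r : CommRingCat.of (invariantAlgebra H) ≅ CommRingCat.of (invariantAlgebra G) :=
      (Scheme.Spec.preimageIso j).unop
    have hr : Spec.map r.hom = j.hom := by
      change Scheme.Spec.map (Scheme.Spec.preimage j.hom) = j.hom
      exact Scheme.Spec.map_preimage j.hom
    refine ⟨AlgEquiv.ofRingEquiv (f := r.commRingCatIsoToRingEquiv) fun z => ?_⟩
    have hw : Spec.map r.hom ≫ Spec.map (CommRingCat.ofHom (algebraMap ℂ (invariantAlgebra H))) =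
        Spec.map (CommRingCat.ofHom (algebraMap ℂ (invariantAlgebra G))) := by
      rw [hr]
      exact Over.w i.hom
    rw [← Spec.map_comp] at hw
    exact congrArg (fun φ => φ.hom z) (Spec.map_injective hw)
  · rintro ⟨e⟩
    refine ⟨Over.isoMk (Scheme.Spec.mapIso e.toRingEquiv.toCommRingCatIso.op) ?_⟩
    change Spec.map _ ≫ Spec.map _ = Spec.map _
    rw [← Spec.map_comp]
    refine congrArg Spec.map (CommRingCat.hom_ext (RingHom.ext fun z => ?_))
    exact e.commutes z

end

theorem lemma2p4 (N : ℕ) (hN : 2 ≤ N)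
    (G H : Subgroup (Matrix.GeneralLinearGroup (Fin N) ℂ)) (hGfin : Finite G) (hHfin : Finite H)
    (hG : WithoutFixedPoints G) (hH : WithoutFixedPoints H) :
    Nonempty (quotientVariety G ≅ quotientVariety H) ↔ ConjugateInGL G H := by
  rw [nonempty_iso_iff_nonempty_algEquiv]
  refine ⟨fun ⟨e⟩ => conjugateInGL_of_algEquiv hN hG hH e, ?_⟩
  rintro ⟨A, rfl⟩
  refine ⟨invariantAlgebraEquiv A (fun g hg => ⟨g, hg, rfl⟩) ?_⟩
  rintro _ ⟨g, hg, rfl⟩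
  simpa [mul_assoc] using hg
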